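/- Let $\mathbb T=\mathbb R/\mathbb Z$ be the torus of length $1$ with the periodic distance $d$, and for a finite non-empty set $S\subset\mathbb T$ let $\delta_S=\max_{x\in\mathbb T}\min_{y\in S}d(x,y)$ be its mesh norm. Let $n\ge 2$ be an integer, let $h>0$ be real, and let $x_1,\dots,x_n$ be independent and uniformly distributed on $\mathbb T$. Then $$\mathbb P\Big\{\exists\,1\le i\le n:\ \delta_{\{x_1,\dots,x_{i-1},x_{i+1},\dots,x_n\}}>\tfrac1h\Big\}\ \le\ \sum_{k=1}^{\lfloor h\rfloor}(-1)^{k+1}\binom nk\Big(1-\frac kh\Big)^{n-1}\ \le\ \sum_{k=1}^{\lfloor 2h\rfloor}(-1)^{k+1}\binom nk\Big(1-\frac k{2h}\Big)^{n-1}.$$ -/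

import Mathlib

open MeasureTheory ProbabilityTheory

/-- The mesh norm `max_{t ∈ 𝕋} min_{y ∈ S} d(t, y)` of a set `S` of nodes on the torus `𝕋 = ℝ/ℤ`,
where `d` (the metric of `UnitAddCircle`) is the periodic distance. For a finite non-empty `S` both
extrema are attained, see `exists_meshNorm_eq_dist`. -/
noncomputable def meshNorm (S : Set UnitAddCircle) : ℝ :=
  ⨆ t : UnitAddCircle, Metric.infDist t S

/-- For finite non-empty `S` the mesh norm is a genuine max-min. -/
theorem exists_meshNorm_eq_dist {S : Set UnitAddCircle} (hS : S.Finite) (hne : S.Nonempty) :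
    (∀ t, Metric.infDist t S ≤ meshNorm S) ∧
      ∃ t, ∃ y ∈ S, meshNorm S = dist t y ∧ ∀ z ∈ S, dist t y ≤ dist t z := by
  have hc : Continuous fun t : UnitAddCircle => Metric.infDist t S := Metric.continuous_infDist_pt S
  have hb : BddAbove (Set.range fun t : UnitAddCircle => Metric.infDist t S) :=
    (isCompact_range hc).bddAbove
  refine ⟨fun t => le_ciSup hb t, ?_⟩
  obtain ⟨t, ht⟩ := (isCompact_range hc).sSup_mem (Set.range_nonempty _)
  obtain ⟨y, hy, hty⟩ := hS.isCompact.exists_infDist_eq_dist hne t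
  refine ⟨t, y, hy, ?_, fun z hz => hty ▸ Metric.infDist_le_dist_of_mem hz⟩
  rw [← hty]
  exact ht.symm

/-! Put `s = 1 / h`. If deleting one node leaves mesh norm above `s`, some `t` has no remaining node
within `s` on either side. The deleted node cannot block both half-arcs, so almost surely an arc of
length `s` following some node is empty (`exists_mem_emptyArc_of_lt_meshNorm`). For `k ≥ 1` given
nodes these arcs are all empty with probability `(1 - k s)₊ ^ (n - 1)` (`volume_iInter_emptyArc`):
root the circle at one node and cut out the prescribed gaps. Inclusion-exclusion makes the middle
sum the exact probability of the union, and the right-hand sum is the same with the shorter arc `1 /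
(2 h)`, hence a larger event. -/

/-! ### Prescribed gaps in an interval. -/

theorem volume_setOf_coord_eq {ι : Type*} [Fintype ι] {i j : ι} (hij : i ≠ j) :
    volume {x : ι → ℝ | x i = x j} = 0 := by
  classical
  let f : (ι → ℝ) →ₗ[ℝ] ℝ := LinearMap.proj (R := ℝ) (φ := fun _ => ℝ) i - LinearMap.proj j
  have hf : LinearMap.ker f ≠ ⊤ := by
    intro h
    have : Pi.single i (1 : ℝ) ∈ LinearMap.ker f := h ▸ Submodule.mem_top
    simp [f, hij.symm] at this
  have := Measure.addHaar_submodule (volume : Measure (ι → ℝ)) _ hf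
  convert this using 2
  ext x
  simp [f, sub_eq_zero]

/-- Point configurations in the interval `(0, L)` in which every point with index in `J` is
followed by a gap of length more than `s`. -/
def gapConfig (ι : Type*) (s L : ℝ) (J : Finset ι) : Set (ι → ℝ) :=
  {x | (∀ l, 0 < x l ∧ x l < L) ∧
    ∀ j ∈ J, x j + s < L ∧ ∀ l, l ≠ j → x l < x j ∨ x j + s < x l}

/-- Configurations in which exactly the points with index in `B` lie to the right of point `j`, and
no other point coincides with it. -/
def rightOf {ι : Type*} [DecidableEq ι] (j : ι) (B : Finset ι) : Set (ι → ℝ) :=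
  {x | ∀ l, l ≠ j → if l ∈ B then x j < x l else x l < x j}

theorem measurableSet_rightOf {ι : Type*} [Fintype ι] [DecidableEq ι] (j : ι) (B : Finset ι) :
    MeasurableSet (rightOf j B) := by
  have : rightOf j B = ⋂ l, ⋂ (_ : l ≠ j), if l ∈ B then {x : ι → ℝ | x j < x l}
      else {x | x l < x j} := by
    ext x
    simp only [rightOf, Set.mem_ofPred_eq, Set.mem_iInter]
    exact forall₂_congr fun l _ => by split_ifs <;> rfl
  rw [this]
  refine .iInter fun l => .iInter fun _ => ?_
  split_ifs <;> exact measurableSet_lt (measurable_pi_apply _) (measurable_pi_apply _)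

theorem volume_eq_sum_rightOf {ι : Type*} [Fintype ι] [DecidableEq ι] (j : ι) (A : Set (ι → ℝ)) :
    volume A = ∑ B ∈ (Finset.univ.erase j).powerset, volume (rightOf j B ∩ A) := by
  simp_rw [← fun B => Measure.restrict_apply (μ := volume) (s := A) (measurableSet_rightOf j B)]
  rw [← measure_biUnion_finset]
  · rw [← Measure.restrict_apply_univ]
    refine measure_congr (ae_restrict_of_ae ?_)
    have : ∀ᵐ x : ι → ℝ, ∀ l, l ≠ j → x l ≠ x j := by
      rw [ae_all_iff]
      intro l
      by_cases hl : l = j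
      · simp [hl]
      · simpa [ae_iff, hl] using volume_setOf_coord_eq hl
    filter_upwards [this] with x hx
    refine propext ⟨fun _ => ?_, fun _ => trivial⟩
    refine Set.mem_biUnion (x := Finset.univ.filter fun l => x j < x l) ?_ ?_
    · simp only [Finset.coe_powerset, Set.mem_preimage, Set.mem_powerset_iff, Finset.coe_subset]
      intro l hl
      simp only [Finset.mem_filter_univ] at hl
      simp only [Finset.mem_erase, Finset.mem_univ, and_true]
      rintro rfl
      exact hl.false
    · intro l hl
      have := hx l hl
      simp only [Finset.mem_filter_univ]
      split_ifs with h
      · exact h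
      · exact lt_of_le_of_ne (not_lt.1 h) this
  · intro B hB C hC hBC
    refine Set.disjoint_left.2 fun x hxB hxC => hBC ?_
    ext l
    have h1 : j ∉ B := fun h => by simpa using Finset.mem_powerset.1 hB h
    have h2 : j ∉ C := fun h => by simpa using Finset.mem_powerset.1 hC h
    by_cases hl : l = j
    · simp [hl, h1, h2]
    have := hxB l hl
    have := hxC l hl
    split_ifs at * <;> grind
  · exact fun B _ => measurableSet_rightOf j B

/-- Closing the gap after `j`: once the set `B` of points to its right is fixed, this is translation
by a constant vector, so it preserves volume. -/
theorem add_mem_gapConfig_inter_rightOf_iff {ι : Type*} [DecidableEq ι]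
    {s L : ℝ} (hs : 0 ≤ s) {J : Finset ι} {j : ι} (hj : j ∉ J)
    {B : Finset ι} (hB : j ∉ B) (y : ι → ℝ) :
    (y + fun l => if l ∈ B then s else 0) ∈ rightOf j B ∩ gapConfig ι s L (insert j J) ↔
      y ∈ rightOf j B ∩ gapConfig ι s (L - s) J := by
  simp only [gapConfig, rightOf, Set.mem_inter_iff, Set.mem_ofPred_eq, Finset.mem_insert,
    forall_eq_or_imp, Pi.add_apply, hB, if_false, add_zero]
  constructor
  · rintro ⟨h5, h1, ⟨h2, h3⟩, h4⟩
    have h6 : ∀ l, l ≠ j → if l ∈ B then y j < y l else y l < y j := by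
      intro l hl
      have := h5 l hl
      have := h3 l hl
      split_ifs at * <;> grind
    refine ⟨h6, fun l => ?_, fun i hi => ?_⟩
    · have := h1 l
      have := h1 j
      by_cases hl : l = j
      · subst hl; grind
      have := h6 l hl
      split_ifs at * <;> grind
    · have hij : i ≠ j := by grind
      have := h6 i hij
      obtain ⟨h7, h8⟩ := h4 i hi
      have h9 := h8 j hij.symm
      refine ⟨?_, fun l hl => ?_⟩
      · split_ifs at * <;> grind
      · have := h8 l hl
        by_cases hlj : l = j
        · subst hlj; split_ifs at * <;> grind
        have := h6 l hlj
        split_ifs at * <;> grind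
  · rintro ⟨h6, h1, h4⟩
    refine ⟨fun l hl => ?_, fun l => ?_, ⟨?_, fun l hl => ?_⟩, fun i hi => ?_⟩
    · have := h6 l hl
      split_ifs at * <;> grind
    · have := h1 l
      split_ifs at * <;> grind
    · have := h1 j
      grind
    · have := h6 l hl
      split_ifs at * <;> grind
    · have hij : i ≠ j := by grind
      have := h6 i hij
      obtain ⟨h7, h8⟩ := h4 i hi
      have h9 := h8 j hij.symm
      refine ⟨?_, fun l hl => ?_⟩
      · split_ifs at * <;> grind
      · have := h8 l hl
        by_cases hlj : l = j
        · subst hlj; split_ifs at * <;> grind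
        have := h6 l hlj
        split_ifs at * <;> grind

/-- Each closed gap shortens the interval by `s`, until a cube remains; `ENNReal.ofReal` gives side
`0` when the gaps do not fit. -/
theorem volume_gapConfig {ι : Type*} [Fintype ι] {s : ℝ} (hs : 0 ≤ s) (L : ℝ) (J : Finset ι) :
    volume (gapConfig ι s L J) = ENNReal.ofReal (L - J.card * s) ^ Fintype.card ι := by
  classical
  induction J using Finset.induction_on generalizing L with
  | empty =>
    have : gapConfig ι s L ∅ = Set.univ.pi fun _ => Set.Ioo 0 L := by
      ext; simp [gapConfig, Set.mem_pi]
    simp [this, Real.volume_pi_Ioo]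
  | insert j J hj ih =>
    have key : volume (gapConfig ι s L (insert j J)) = volume (gapConfig ι s (L - s) J) := by
      rw [volume_eq_sum_rightOf j, volume_eq_sum_rightOf j (gapConfig ι s (L - s) J)]
      refine Finset.sum_congr rfl fun B hB => ?_
      have hB : j ∉ B := fun h => by simpa using Finset.mem_powerset.1 hB h
      rw [← measure_preimage_add_right volume (fun l => if l ∈ B then s else 0)]
      congr 1
      ext y
      exact add_mem_gapConfig_inter_rightOf_iff hs hj hB y
    rw [key, ih, Finset.card_insert_of_notMem hj]
    congr 2
    push_cast
    ring

/-! ### Arc length on the circle. -/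

/-- The length in `[0, 1)` of the counterclockwise arc from `0` to `z`. -/
noncomputable def arcLength (z : UnitAddCircle) : ℝ :=
  AddCircle.equivIco 1 0 z

theorem arcLength_nonneg (z : UnitAddCircle) : 0 ≤ arcLength z :=
  (AddCircle.equivIco 1 0 z).2.1

theorem arcLength_lt_one (z : UnitAddCircle) : arcLength z < 1 :=
  (AddCircle.equivIco 1 0 z).2.2.trans_eq (zero_add 1)

@[simp]
theorem coe_arcLength (z : UnitAddCircle) : (arcLength z : UnitAddCircle) = z :=
  AddCircle.coe_equivIco

theorem arcLength_coe {x : ℝ} (h0 : 0 ≤ x) (h1 : x < 1) : arcLength (x : UnitAddCircle) = x :=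
  congrArg Subtype.val (AddCircle.equivIco_coe_eq (p := (1 : ℝ)) (a := 0) ⟨h0, by simpa using h1⟩)

theorem measurable_arcLength : Measurable arcLength :=
  measurable_subtype_coe.comp (AddCircle.measurableEquivIco 1 0).measurable

theorem coe_add_one (x : ℝ) : ((x + 1 : ℝ) : UnitAddCircle) = x :=
  AddCircle.coe_add_period 1 x

theorem norm_coe_le_abs (x : ℝ) : ‖(x : UnitAddCircle)‖ ≤ |x| := by
  simpa [UnitAddCircle.norm_eq] using round_le x 0

theorem norm_le_arcLength (z : UnitAddCircle) : ‖z‖ ≤ arcLength z := by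
  conv_lhs => rw [← coe_arcLength z]
  exact (norm_coe_le_abs _).trans_eq (abs_of_nonneg (arcLength_nonneg z))

theorem norm_le_one_sub_arcLength (z : UnitAddCircle) : ‖z‖ ≤ 1 - arcLength z := by
  have : z = ((arcLength z - 1 : ℝ) : UnitAddCircle) := by
    rw [← coe_add_one, sub_add_cancel, coe_arcLength]
  conv_lhs => rw [this]
  refine (norm_coe_le_abs _).trans_eq ?_
  rw [abs_sub_comm, abs_of_pos (sub_pos.2 (arcLength_lt_one z))]

theorem arcLength_sub_of_le {z w : UnitAddCircle} (h : arcLength w ≤ arcLength z) :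
    arcLength (z - w) = arcLength z - arcLength w := by
  have := arcLength_nonneg w
  have := arcLength_lt_one z
  rw [← arcLength_coe (x := arcLength z - arcLength w) (by linarith) (by linarith),
    AddCircle.coe_sub, coe_arcLength, coe_arcLength]

theorem arcLength_sub_of_lt {z w : UnitAddCircle} (h : arcLength z < arcLength w) :
    arcLength (z - w) = arcLength z - arcLength w + 1 := by
  have := arcLength_nonneg z
  have := arcLength_lt_one w
  rw [← arcLength_coe (x := arcLength z - arcLength w + 1) (by linarith) (by linarith),
    coe_add_one, AddCircle.coe_sub, coe_arcLength, coe_arcLength]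

@[simp]
theorem arcLength_zero : arcLength 0 = 0 := by
  simpa using arcLength_coe (x := 0) le_rfl one_pos

/-! ### Probability that given arcs are empty. -/

/-- Configurations on the circle in which the arc of length `s` that follows point `j`
counterclockwise contains no other point. -/
def emptyArc {ι : Type*} (s : ℝ) (j : ι) : Set (ι → UnitAddCircle) :=
  {x | ∀ l, l ≠ j → s < arcLength (x l - x j)}

theorem measurableSet_emptyArc {ι : Type*} [Countable ι] (s : ℝ) (j : ι) :
    MeasurableSet (emptyArc s j) := by
  have : emptyArc s j =
      ⋂ l, ⋂ (_ : l ≠ j), {x : ι → UnitAddCircle | s < arcLength (x l - x j)} := by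
    ext x
    simp [emptyArc]
  rw [this]
  exact .iInter fun l => .iInter fun _ => measurableSet_lt measurable_const
    (measurable_arcLength.comp ((measurable_pi_apply l).sub (measurable_pi_apply j)))

theorem emptyArc_anti {ι : Type*} {s t : ℝ} (h : s ≤ t) (j : ι) : emptyArc t j ⊆ emptyArc s j :=
  fun _ hx l hl => h.trans_lt (hx l hl)

theorem volume_preimage_coe_inter_Ioc {ι : Type*} [Fintype ι] {A : Set (ι → UnitAddCircle)}
    (hA : MeasurableSet A) :
    volume A = volume ((fun (x : ι → ℝ) l => (x l : UnitAddCircle)) ⁻¹' A ∩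
      Set.univ.pi fun _ => Set.Ioc 0 1) := by
  have h := measurePreserving_pi (ι := ι) (fun _ => volume.restrict (Set.Ioc (0 : ℝ) 1))
    (fun _ => (volume : Measure UnitAddCircle))
    (fun _ => by simpa using UnitAddCircle.measurePreserving_mk 0)
  rw [volume_pi, ← h.measure_preimage hA.nullMeasurableSet, ← Measure.restrict_pi_pi,
    Measure.restrict_apply (h.measurable hA), volume_pi]

theorem volume_setOf_coord_eq_circle {ι : Type*} [Fintype ι] {i j : ι} (hij : i ≠ j) :
    volume {x : ι → UnitAddCircle | x i = x j} = 0 := by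
  rw [volume_preimage_coe_inter_Ioc
    (measurableSet_eq_fun (measurable_pi_apply i) (measurable_pi_apply j))]
  refine measure_mono_null (fun x hx => ?_) (volume_setOf_coord_eq hij)
  have h : (x i : UnitAddCircle) = x j := hx.1
  have hi := hx.2 i trivial
  have hj := hx.2 j trivial
  exact (AddCircle.coe_eq_coe_iff_of_mem_Ioc (p := (1 : ℝ)) (a := 0)
    (by simpa using hi) (by simpa using hj)).1 h

/-- Configurations on the circle that, together with a point at the origin, have an empty arc of
length `s` after the origin and after each point with index in `J`. -/
def rootedConfig (ι : Type*) (s : ℝ) (J : Finset ι) : Set (ι → UnitAddCircle) :=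
  {y | (∀ l, s < arcLength (y l)) ∧
    ∀ j ∈ J, s < arcLength (-y j) ∧ ∀ l, l ≠ j → s < arcLength (y l - y j)}

theorem measurableSet_rootedConfig (ι : Type*) [Countable ι] (s : ℝ) (J : Finset ι) :
    MeasurableSet (rootedConfig ι s J) := by
  have : rootedConfig ι s J = (⋂ l, {y : ι → UnitAddCircle | s < arcLength (y l)}) ∩
      ⋂ j ∈ J, ({y : ι → UnitAddCircle | s < arcLength (-y j)} ∩ emptyArc s j) := by
    ext y
    simp [rootedConfig, emptyArc]
  rw [this]
  exact .inter (.iInter fun l => measurableSet_lt measurable_const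
    (measurable_arcLength.comp (measurable_pi_apply l)))
    (.biInter J.countable_toSet fun j _ => .inter (measurableSet_lt measurable_const
      (measurable_arcLength.comp (measurable_pi_apply j).neg)) (measurableSet_emptyArc s j))

/-- If `x < y`, the arc from `y` to `x` passes the origin and then covers length `x > s`, so it
imposes no condition. -/
theorem lt_arcLength_coe_sub_coe_iff {s x y : ℝ} (hs : 0 ≤ s) (hx : s < x) (hx1 : x < 1)
    (hy : s < y) (hy1 : y < 1) :
    s < arcLength ((x : UnitAddCircle) - y) ↔ x < y ∨ y + s < x := by
  have ex := arcLength_coe (hs.trans hx.le) hx1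
  have ey := arcLength_coe (hs.trans hy.le) hy1
  rcases lt_or_ge x y with h | h
  · rw [arcLength_sub_of_lt (by rwa [ex, ey]), ex, ey]
    exact ⟨fun _ => .inl h, fun _ => by linarith⟩
  · rw [arcLength_sub_of_le (by rwa [ex, ey]), ex, ey]
    exact ⟨fun _ => .inr (by linarith), fun h => by rcases h with h | h <;> linarith⟩

theorem lt_arcLength_coe_iff {s x : ℝ} (hs : 0 ≤ s) (hx : 0 < x) (hx1 : x ≤ 1) :
    s < arcLength (x : UnitAddCircle) ↔ s < x ∧ x < 1 := by
  rcases hx1.eq_or_lt with rfl | h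
  · have : ((1 : ℝ) : UnitAddCircle) = 0 := AddCircle.coe_period 1
    simp [this, hs]
  · rw [arcLength_coe hx.le h]
    simp [h]

theorem lt_arcLength_neg_coe_iff {s x : ℝ} (hx : 0 < x) (hx1 : x < 1) :
    s < arcLength (-(x : UnitAddCircle)) ↔ x + s < 1 := by
  rw [← zero_sub, arcLength_sub_of_lt (by rwa [arcLength_zero, arcLength_coe hx.le hx1]),
    arcLength_zero, arcLength_coe hx.le hx1]
  constructor <;> intro <;> linarith

theorem volume_rootedConfig {ι : Type*} [Fintype ι] {s : ℝ} (hs : 0 ≤ s) (J : Finset ι) :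
    volume (rootedConfig ι s J) = ENNReal.ofReal (1 - (J.card + 1) * s) ^ Fintype.card ι := by
  have : 1 - (J.card + 1) * s = 1 - s - J.card * s := by ring
  rw [this, ← volume_gapConfig hs, volume_preimage_coe_inter_Ioc (measurableSet_rootedConfig ι s J),
    -- The arc after the origin is empty, so measuring positions from `s` leaves an interval of
    -- length `1 - s`.
    ← measure_preimage_add_right volume (fun _ => s)]
  congr 1
  ext y
  simp only [rootedConfig, gapConfig, Set.mem_preimage, Set.mem_inter_iff, Set.mem_ofPred_eq,
    Set.mem_univ_pi, Pi.add_apply, Set.mem_Ioc]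
  constructor
  · rintro ⟨⟨h1, h2⟩, h3⟩
    have h4 l := (lt_arcLength_coe_iff hs (h3 l).1 (h3 l).2).1 (h1 l)
    refine ⟨fun l => ⟨by linarith [h4 l], by linarith [h4 l]⟩, fun j hj => ⟨?_, fun l hl => ?_⟩⟩
    · linarith [(lt_arcLength_neg_coe_iff (h3 j).1 (h4 j).2).1 (h2 j hj).1]
    · refine ((lt_arcLength_coe_sub_coe_iff hs (h4 l).1 (h4 l).2 (h4 j).1 (h4 j).2).1
        ((h2 j hj).2 l hl)).imp ?_ ?_ <;> intro <;> linarith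
  · rintro ⟨h1, h2⟩
    have h4 l : s < y l + s ∧ y l + s < 1 := ⟨by linarith [h1 l], by linarith [h1 l]⟩
    have h3 l : 0 < y l + s := by linarith [h4 l]
    refine ⟨⟨fun l => (lt_arcLength_coe_iff hs (h3 l) (h4 l).2.le).2 (h4 l),
      fun j hj => ⟨?_, fun l hl => ?_⟩⟩, fun l => ⟨h3 l, (h4 l).2.le⟩⟩
    · exact (lt_arcLength_neg_coe_iff (h3 j) (h4 j).2).2 (by linarith [(h2 j hj).1])
    · refine (lt_arcLength_coe_sub_coe_iff hs (h4 l).1 (h4 l).2 (h4 j).1 (h4 j).2).2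
        (((h2 j hj).2 l hl).imp ?_ ?_) <;> intro <;> linarith

theorem volume_iInter_emptyArc {m : ℕ} {s : ℝ} (hs : 0 ≤ s) {J : Finset (Fin (m + 1))}
    (hJ : J.Nonempty) :
    volume (⋂ j ∈ J, emptyArc s j) = ENNReal.ofReal (1 - J.card * s) ^ m := by
  classical
  obtain ⟨i, hi⟩ := hJ
  let J' : Finset (Fin m) := Finset.univ.filter fun l => i.succAbove l ∈ J
  have hcard : J.card = J'.card + 1 := by
    have : J = insert i (J'.map i.succAboveEmb) := by
      ext l
      rcases Fin.eq_self_or_eq_succAbove i l with rfl | ⟨l, rfl⟩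
      · simp [hi]
      · simp [J', Fin.succAbove_ne]
    conv_lhs => rw [this]
    rw [Finset.card_insert_of_notMem (by simp [Fin.succAbove_ne]), Finset.card_map]
  have hmeas : MeasurableSet (⋂ j ∈ J, emptyArc s j) :=
    .biInter J.countable_toSet fun j _ => measurableSet_emptyArc s j
  let e := MeasurableEquiv.piFinSuccAbove (fun _ : Fin (m + 1) => UnitAddCircle) i
  have he : MeasurePreserving e.symm := (volume_preserving_piFinSuccAbove _ i).symm
  rw [← he.measure_preimage hmeas.nullMeasurableSet, Measure.volume_eq_prod,
    Measure.prod_apply (e.symm.measurable hmeas)]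
  -- By rotation invariance the fibre over the position `t` of point `i` has a volume independent of
  -- `t`.
  have hfib (t : UnitAddCircle) :
      volume (Prod.mk t ⁻¹' (e.symm ⁻¹' ⋂ j ∈ J, emptyArc s j)) =
        volume (rootedConfig (Fin m) s J') := by
    rw [← measure_preimage_add_right volume (fun _ => t)]
    congr 1
    ext y
    have h0 : e.symm (t, y + fun _ => t) i = t := by
      simp [e]
    have h1 l : e.symm (t, y + fun _ => t) (i.succAbove l) = y l + t := by
      simp [e]
    simp only [Set.mem_preimage, Set.mem_iInter, emptyArc, rootedConfig, Set.mem_ofPred_eq]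
    constructor
    · intro h
      refine ⟨fun l => by simpa [h0, h1] using h i hi _ (i.succAbove_ne l), fun j hj => ⟨?_, ?_⟩⟩
      · simpa [h0, h1] using h (i.succAbove j) (by simpa [J'] using hj) i (i.succAbove_ne j).symm
      · intro l hl
        simpa [h1] using h (i.succAbove j) (by simpa [J'] using hj) (i.succAbove l)
          (i.succAbove_right_injective.ne hl)
    · rintro ⟨h2, h3⟩
      refine (Fin.forall_iff_succAbove i).2 ⟨fun _ => (Fin.forall_iff_succAbove i).2
        ⟨fun hl => (hl rfl).elim, fun l _ => by simpa [h0, h1] using h2 l⟩, fun j hj =>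
          (Fin.forall_iff_succAbove i).2 ⟨fun _ => ?_, fun l hl => ?_⟩⟩
      · simpa [h0, h1] using (h3 j (by simpa [J'] using hj)).1
      · simpa [h1] using (h3 j (by simpa [J'] using hj)).2 l (by rintro rfl; exact hl rfl)
  simp [hfib, volume_rootedConfig hs, hcard]

theorem measureReal_iUnion_emptyArc {n : ℕ} (hn : 2 ≤ n) {h : ℝ} (hh : 0 < h) :
    volume.real (⋃ j : Fin n, emptyArc (1 / h) j) =
      ∑ k ∈ Finset.Icc 1 ⌊h⌋₊, (-1 : ℝ) ^ (k + 1) * (n.choose k : ℝ) *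
        (1 - (k : ℝ) / h) ^ (n - 1) := by
  obtain ⟨m, rfl⟩ : ∃ m, n = m + 1 := ⟨n - 1, by omega⟩
  have hm : m ≠ 0 := by omega
  -- The value `0` at `k = 0` lets the sum over nonempty subsets run over all subsets.
  let f : ℕ → ℝ := fun k => if k = 0 then 0 else (-1 : ℝ) ^ (k + 1) * max (1 - k / h) 0 ^ m
  have hf (u : Finset (Fin (m + 1))) (hu : u.Nonempty) :
      (-1 : ℝ) ^ (u.card + 1) * volume.real (⋂ i ∈ u, emptyArc (1 / h) i) = f u.card := by
    simp only [f, hu.card_ne_zero, if_false, measureReal_def,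
      volume_iInter_emptyArc (one_div_nonneg.2 hh.le) hu, ENNReal.toReal_pow, ENNReal.toReal_ofReal',
      mul_one_div]
  have h1 : volume.real (⋃ j : Fin (m + 1), emptyArc (1 / h) j) =
      ∑ k ∈ Finset.range (m + 2), (m + 1).choose k • f k := by
    have := measureReal_biUnion_eq_sum_powerset
      (μ := (volume : Measure (Fin (m + 1) → UnitAddCircle))) (t := Finset.univ)
      (s := fun j => emptyArc (1 / h) j) fun j _ => measurableSet_emptyArc _ j
    simp only [Finset.mem_univ, Set.iUnion_true] at this
    rw [this, Finset.sum_congr rfl fun u hu => hf u (Finset.mem_filter.1 hu).2,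
      Finset.sum_filter_of_ne, Finset.sum_powerset_apply_card, Finset.card_fin]
    intro u _ hu
    by_contra hne
    simp [Finset.not_nonempty_iff_eq_empty.1 hne, f] at hu
  rw [h1, Nat.add_sub_cancel]
  -- Both sums extend by zeros to a common range: binomials vanish beyond `n`, and positive parts
  -- beyond `h`, where `m ≠ 0` excludes `0 ^ 0`.
  have h2 : ∑ k ∈ Finset.range (m + 2), (m + 1).choose k • f k =
      ∑ k ∈ Finset.range (m + 2 + ⌊h⌋₊), (m + 1).choose k • f k := by
    refine Finset.sum_subset (Finset.range_mono (by omega)) fun k _ hk => ?_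
    rw [Nat.choose_eq_zero_of_lt (by rw [Finset.mem_range] at hk; omega), zero_smul]
  have h3 : ∑ k ∈ Finset.Icc 1 ⌊h⌋₊, (m + 1).choose k • f k =
      ∑ k ∈ Finset.range (m + 2 + ⌊h⌋₊), (m + 1).choose k • f k := by
    refine Finset.sum_subset (fun k hk => ?_) fun k _ hk => ?_
    · rw [Finset.mem_Icc] at hk
      rw [Finset.mem_range]
      omega
    · rcases eq_or_ne k 0 with rfl | hk0
      · simp [f]
      · have : h < k := Nat.lt_of_floor_lt (by rw [Finset.mem_Icc] at hk; omega)
        have : 1 - k / h ≤ 0 := sub_nonpos.2 ((one_le_div hh).2 this.le)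
        simp [f, hk0, max_eq_right this, hm]
  rw [h2, ← h3]
  refine Finset.sum_congr rfl fun k hk => ?_
  rw [Finset.mem_Icc] at hk
  have : 0 ≤ 1 - k / h :=
    sub_nonneg.2 ((div_le_one hh).2 ((Nat.le_floor_iff hh.le).1 hk.2))
  simp only [f, Nat.one_le_iff_ne_zero.1 hk.1, if_false, max_eq_left this, nsmul_eq_mul]
  ring

/-! ### From mesh norm to empty arcs. -/

/-- If the arc of length `s` that starts at `t` contains none of the pairwise distinct points
`x l`, then neither does the arc that starts at the last of these points before `t`. -/
theorem exists_mem_emptyArc_of_forall_lt {ι : Type*} [Finite ι] [Nonempty ι]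
    {x : ι → UnitAddCircle} (hx : Function.Injective x) {s : ℝ} {t : UnitAddCircle}
    (ht : ∀ l, s < arcLength (x l - t)) : ∃ j, x ∈ emptyArc s j := by
  -- The last point before `t` is the farthest from `t` counterclockwise.
  obtain ⟨j, hj⟩ := Finite.exists_max fun l => arcLength (x l - t)
  refine ⟨j, fun l hl => ?_⟩
  rw [← sub_sub_sub_cancel_right (x l) (x j) t]
  rcases (hj l).lt_or_eq with h | h
  · rw [arcLength_sub_of_lt h]
    linarith [ht l, arcLength_lt_one (x j - t)]
  · refine (hl (hx ?_)).elim
    have := congrArg ((↑) : ℝ → UnitAddCircle) h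
    simpa using this

theorem exists_mem_emptyArc_of_lt_meshNorm {ι : Type*} [Finite ι] [Nontrivial ι]
    {x : ι → UnitAddCircle} (hx : Function.Injective x) {s : ℝ} (hs : 0 ≤ s) {i : ι}
    (h : s < meshNorm {z | ∃ j, j ≠ i ∧ x j = z}) : ∃ j, x ∈ emptyArc s j := by
  obtain ⟨t, ht⟩ := exists_lt_of_lt_ciSup h
  have hnorm l (hl : l ≠ i) : s < ‖x l - t‖ := by
    rw [← dist_eq_norm, dist_comm]
    exact ht.trans_le (Metric.infDist_le_dist_of_mem ⟨l, hl, rfl⟩)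
  have h1 l (hl : l ≠ i) : s < arcLength (x l - t) := (hnorm l hl).trans_le (norm_le_arcLength _)
  have h2 l (hl : l ≠ i) : s < 1 - arcLength (x l - t) :=
    (hnorm l hl).trans_le (norm_le_one_sub_arcLength _)
  -- If `x i = t`, the arc after `x i` itself is empty. Otherwise start at `t` when `x i` lies
  -- beyond `t + s`, and at `t - s` when it lies in `(t, t + s]`.
  rcases (arcLength_nonneg (x i - t)).eq_or_lt with h0 | h0
  · refine ⟨i, fun l hl => ?_⟩
    have : x i = t := by
      rw [← sub_eq_zero, ← coe_arcLength (x i - t), ← h0, AddCircle.coe_zero]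
    rw [this]
    exact h1 l hl
  · rcases lt_or_ge s (arcLength (x i - t)) with h3 | h3
    · refine exists_mem_emptyArc_of_forall_lt hx (t := t) fun l => ?_
      rcases eq_or_ne l i with rfl | hl
      · exact h3
      · exact h1 l hl
    · obtain ⟨l₀, hl₀⟩ := exists_ne i
      have h4 l : 0 < arcLength (x l - t) ∧ s < 1 - arcLength (x l - t) := by
        rcases eq_or_ne l i with rfl | hl
        -- A second point forces `s < 1 / 2`, so `x i`, within `s` after `t`, is not in the arc
        -- before `t`.
        · exact ⟨h0, by linarith [h1 l₀ hl₀, h2 l₀ hl₀]⟩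
        · exact ⟨hs.trans_lt (h1 l hl), h2 l hl⟩
      refine exists_mem_emptyArc_of_forall_lt hx (t := t - (s : UnitAddCircle)) fun l => ?_
      have : x l - (t - (s : UnitAddCircle)) = ((arcLength (x l - t) + s : ℝ) : UnitAddCircle) := by
        rw [AddCircle.coe_add, coe_arcLength]
        abel
      rw [this, arcLength_coe] <;> linarith [h4 l]

theorem lemma4p2 {Ω : Type*} [MeasurableSpace Ω] (μ : Measure Ω) [IsProbabilityMeasure μ]
    (n : ℕ) (hn : 2 ≤ n) (h : ℝ) (hh : 0 < h)
    (X : Fin n → Ω → UnitAddCircle)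
    (hunif : ∀ i, HasLaw (X i) (volume : Measure UnitAddCircle) μ)
    (hindep : iIndepFun X μ) :
    μ.real {ω | ∃ i : Fin n, 1 / h < meshNorm {x | ∃ j : Fin n, j ≠ i ∧ X j ω = x}}
        ≤ ∑ k ∈ Finset.Icc 1 ⌊h⌋₊, (-1 : ℝ) ^ (k + 1) * (n.choose k : ℝ) *
            (1 - (k : ℝ) / h) ^ (n - 1) ∧
      ∑ k ∈ Finset.Icc 1 ⌊h⌋₊, (-1 : ℝ) ^ (k + 1) * (n.choose k : ℝ) *
            (1 - (k : ℝ) / h) ^ (n - 1)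
        ≤ ∑ k ∈ Finset.Icc 1 ⌊2 * h⌋₊, (-1 : ℝ) ^ (k + 1) * (n.choose k : ℝ) *
            (1 - (k : ℝ) / (2 * h)) ^ (n - 1) := by
  have : Nontrivial (Fin n) := Fin.nontrivial_iff_two_le.2 hn
  have hX : AEMeasurable (fun ω i => X i ω) μ :=
    aemeasurable_pi_lambda _ fun i => (hunif i).aemeasurable
  have hlaw : μ.map (fun ω i => X i ω) = volume := by
    rw [hindep.map_fun_eq_pi_map fun i => (hunif i).aemeasurable, volume_pi]
    simp_rw [fun i => (hunif i).map_eq]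
  rw [← measureReal_iUnion_emptyArc hn hh, ← measureReal_iUnion_emptyArc hn (by positivity)]
  constructor
  · have hdist : ∀ᵐ x : Fin n → UnitAddCircle, Function.Injective x := by
      have : ∀ᵐ x : Fin n → UnitAddCircle, ∀ i j, i ≠ j → x i ≠ x j := by
        simp_rw [ae_all_iff]
        intro i j hij
        simpa [ae_iff] using volume_setOf_coord_eq_circle hij
      filter_upwards [this] with x hx i j hij
      by_contra hne
      exact hx i j hne hij
    have hdist' : ∀ᵐ ω ∂μ, Function.Injective fun i => X i ω := by
      rw [← hlaw] at hdist
      exact ae_of_ae_map hX hdist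
    have hmeas : MeasurableSet (⋃ j : Fin n, emptyArc (1 / h) j) :=
      .iUnion fun j => measurableSet_emptyArc _ j
    rw [← hlaw, map_measureReal_apply_of_aemeasurable hX hmeas]
    refine ENNReal.toReal_mono (measure_ne_top _ _) (measure_mono_ae ?_)
    filter_upwards [hdist'] with ω hω
    rintro ⟨i, hi⟩
    exact Set.mem_iUnion.2 (exists_mem_emptyArc_of_lt_meshNorm hω (one_div_nonneg.2 hh.le) hi)
  · exact measureReal_mono (Set.iUnion_mono fun j =>
      emptyArc_anti (one_div_le_one_div_of_le hh (by linarith)) j)
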